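/- Let $k$ be a field and let $S$ be a finite poset. An $S$-space is a family $\mathbf V=(V,V(s))_{s\in S}$, where $V$ is a finite dimensional $k$-vector space, each $V(s)$ is a subspace of $V$, and $s\le t$ implies $V(s)\subseteq V(t)$. A morphism $(U,U(s))\to(V,V(s))$ is a $k$-linear map $f:U\to V$ with $f(U(s))\subseteq V(s)$ for all $s\in S$, and the direct sum is $(U\oplus V,\,U(s)\oplus V(s))_{s\in S}$. An $S$-space is zero if its ambient space $V$ is zero, and a nonzero $S$-space is indecomposable if it is not isomorphic to a direct sum of two nonzero $S$-spaces. Denote by $\nu(S)$ the cardinality of the set of isomorphism classes of indecomposable $S$-spaces; $S$ is finitely represented if $\nu(S)$ is finite. For a poset $P$, the width $w(P)$ is the largest cardinality of an antichain in $P$, and $a(P)$ is the set of nonempty antichains of $P$. Denote by $\hat a(P)$ the set $a(P)$ partially ordered by: $A\le B$ if and only if for every $b\in B$ there is an $a\in A$ with $a\le b$. Identify $s\in P$ with $\{s\}\in\hat a(P)$. For $p\in S$ put $\langle p\rangle=\{s\in S\mid p\le s\}$, let $S_{\langle p\rangle}=\langle p\rangle\cup\hat a(S\setminus\langle p\rangle)$,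 viewed as a subposet of $\hat a(S)$, and let $S_p=S_{\langle p\rangle}\setminus\{A\in S_{\langle p\rangle}\mid A\le p\}$, with the induced order. If $p\in S$ satisfies $w(S\setminus\langle p\rangle)\le 2$, then $$\nu(S)=\nu(S_p)+\bigl|a(S\setminus\langle p\rangle)\bigr|+1$$ (an equality of cardinals). In particular, $S$ is finitely represented if and only if $S_p$ is. -/

import Mathlib

open CategoryTheory

universe u v

/-! ### Representations of a poset -/

/-- An `S`-space over the field `k`: a finite dimensional `k`-vector space (the ambient space)
together with subspaces `V(s)`, `s ∈ S`, such that `s ≤ t` implies `V(s) ⊆ V(t)`. -/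
structure SSpace (k : Type u) [Field k] (S : Type v) [PartialOrder S] where
  /-- the ambient space -/
  carrier : Type u
  [addCommGroup : AddCommGroup carrier]
  [module : Module k carrier]
  [finiteDimensional : FiniteDimensional k carrier]
  /-- the subspaces -/
  sub : S → Submodule k carrier
  sub_mono : ∀ s t : S, s ≤ t → sub s ≤ sub t

namespace SSpace

attribute [instance] SSpace.addCommGroup SSpace.module SSpace.finiteDimensional

variable {k : Type u} [Field k] {S : Type v} [PartialOrder S]

/-- A morphism of `S`-spaces `U → V` is a linear map `f` of the ambient spaces with
`f(U(s)) ⊆ V(s)` for all `s`. -/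
@[ext]
structure Hom (U V : SSpace k S) where
  toLin : U.carrier →ₗ[k] V.carrier
  map_sub_le : ∀ s : S, (U.sub s).map toLin ≤ V.sub s

/-- The category of `S`-spaces. -/
instance : Category (SSpace k S) where
  Hom U V := Hom U V
  id U := ⟨LinearMap.id, fun s => by rw [Submodule.map_id]⟩
  comp f g := ⟨g.toLin ∘ₗ f.toLin, fun s => by
    rw [Submodule.map_comp]
    exact (Submodule.map_mono (f.map_sub_le s)).trans (g.map_sub_le s)⟩

/-- The direct sum of two `S`-spaces: ambient space `U ⊕ V`, subspaces `U(s) ⊕ V(s)`. -/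
def directSum (U V : SSpace k S) : SSpace k S where
  carrier := U.carrier × V.carrier
  sub s := (U.sub s).prod (V.sub s)
  sub_mono s t h := Submodule.prod_mono (U.sub_mono s t h) (V.sub_mono s t h)

/-- An `S`-space is zero if its ambient space is zero. -/
def IsZero (V : SSpace k S) : Prop := Subsingleton V.carrier

/-- A nonzero `S`-space is indecomposable if it is not isomorphic to the direct sum of two nonzero
`S`-spaces. -/
def IsIndecomposable (V : SSpace k S) : Prop :=
  ¬ V.IsZero ∧
    ∀ U W : SSpace k S, Nonempty (V ≅ directSum U W) → U.IsZero ∨ W.IsZero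

end SSpace

/-- The set of isomorphism classes of indecomposable `S`-spaces. -/
def indecClasses (k : Type u) [Field k] (S : Type v) [PartialOrder S] :
    Set (Quotient (isIsomorphicSetoid (SSpace k S))) :=
  {x | ∃ V : SSpace k S, V.IsIndecomposable ∧ Quotient.mk _ V = x}

/-- `ν(S)`, the cardinality of the set of isomorphism classes of indecomposable `S`-spaces. -/
noncomputable def nu (k : Type u) [Field k] (S : Type v) [PartialOrder S] :
    Cardinal.{max (u + 1) v} :=
  Cardinal.mk (indecClasses k S)

/-- `S` is finitely represented (over `k`) if `ν(S)` is finite. -/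
def FinitelyRepresented (k : Type u) [Field k] (S : Type v) [PartialOrder S] : Prop :=
  nu k S < Cardinal.aleph0

/-! ### Antichains and the derived poset -/

/-- The width of a poset: the largest cardinality of an antichain in it. -/
noncomputable def posetWidth (P : Type v) [PartialOrder P] : ℕ∞ :=
  ⨆ A : {A : Set P // IsAntichain (· ≤ ·) A}, A.1.encard

/-- The set `a(P)` of nonempty antichains of `P`. -/
@[ext]
structure AntichainHat (P : Type v) [PartialOrder P] where
  carrier : Set P
  isAntichain : IsAntichain (· ≤ ·) carrier
  nonempty : carrier.Nonempty

namespace AntichainHat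

variable {P : Type v} [PartialOrder P]

/-- The poset `â(P)`: for antichains `A`, `B`, one has `A ≤ B` if and only if every element of `B`
is above some element of `A`. -/
instance : PartialOrder (AntichainHat P) where
  le A B := ∀ b ∈ B.carrier, ∃ a ∈ A.carrier, a ≤ b
  le_refl A := fun a ha => ⟨a, ha, le_rfl⟩
  le_trans A B C hAB hBC := fun c hc => by
    obtain ⟨b, hb, hbc⟩ := hBC c hc
    obtain ⟨a, ha, hab⟩ := hAB b hb
    exact ⟨a, ha, hab.trans hbc⟩
  le_antisymm A B hAB hBA := by
    have key : ∀ X Y : AntichainHat P, (∀ b ∈ Y.carrier, ∃ a ∈ X.carrier, a ≤ b) →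
        (∀ b ∈ X.carrier, ∃ a ∈ Y.carrier, a ≤ b) → X.carrier ⊆ Y.carrier := by
      intro X Y hXY hYX x hx
      obtain ⟨y, hy, hyx⟩ := hYX x hx
      obtain ⟨x', hx', hxy⟩ := hXY y hy
      have hxx : x' = x := X.isAntichain.eq hx' hx (hxy.trans hyx)
      have : y = x := le_antisymm hyx (hxx ▸ hxy)
      exact this ▸ hy
    exact AntichainHat.ext (Set.Subset.antisymm (key A B hAB hBA) (key B A hBA hAB))

/-- The one-element antichain `{s}`; this is how `P` is regarded as a subposet of `â(P)`. -/
def single (s : P) : AntichainHat P :=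
  ⟨{s}, IsAntichain.singleton, Set.singleton_nonempty s⟩

end AntichainHat

/-- The subposet `S_⟨p⟩ = ⟨p⟩ ∪ â(S ∖ ⟨p⟩)` of `â(S)`, where `⟨p⟩ = {s | p ≤ s}`. -/
def filterExtension {S : Type v} [PartialOrder S] (p : S) : Set (AntichainHat S) :=
  (AntichainHat.single '' Set.Ici p) ∪ {A | A.carrier ⊆ (Set.Ici p)ᶜ}

/-- The derived poset `S_p` with respect to the principal filter `⟨p⟩`: the complement in `S_⟨p⟩`
of the principal ideal generated by `p`. -/
def derivedPoset {S : Type v} [PartialOrder S] (p : S) : Set (AntichainHat S) :=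
  filterExtension p \ Set.Iic (AntichainHat.single p)

/-! Differentiation sends an `S`-space `V` to `V / V(p)`, with the image of `⋂ a ∈ A, V(a)` at each
antichain `A` in `S_p`. It is a functor to `S_p`-spaces, and the count follows from three facts.

Fullness (`exists_compatible_of_derive`) is where the width enters. A family of subspaces indexed by
a poset of width at most two always splits off a line (`exists_line_splitting`). Hence a linear lift
compatible with the family exists as soon as each single vector lifts compatibly
(`exists_compatible_lift`), and the antichains in `S_p` encode exactly this vectorwise condition.

Density (`equivalent_derive_integrate`) comes from an explicit integral.

By Fitting's lemma, fullness makes differentiation preserve indecomposability and reflect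
isomorphism on indecomposables with `V(p) ≠ V`. With density this is a bijection onto the classes
counted by `ν(S_p)`.

If `V(p) = V`, only the family on `S ∖ ⟨p⟩` matters, so an indecomposable `V` is itself a line.
Lines correspond to up-sets containing `p`, that is, to possibly empty antichains of `S ∖ ⟨p⟩`; the
empty one accounts for the `+ 1`. -/

namespace SSpace

variable {k : Type u} [Field k] {S : Type v} [PartialOrder S]

/-! ### Compatible maps, idempotents and Fitting's lemma -/

/-- A linear map between the ambient spaces of two `S`-spaces is compatible if it maps each
subspace into the corresponding one. -/
def Compatible (U V : SSpace k S) (f : U.carrier →ₗ[k] V.carrier) : Prop :=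
  ∀ s, ∀ x ∈ U.sub s, f x ∈ V.sub s

theorem Compatible.comp {U V W : SSpace k S} {g : V.carrier →ₗ[k] W.carrier}
    {f : U.carrier →ₗ[k] V.carrier} (hg : Compatible V W g) (hf : Compatible U V f) :
    Compatible U W (g ∘ₗ f) :=
  fun s x hx => hg s _ (hf s x hx)

theorem Compatible.pow {V : SSpace k S} {f : Module.End k V.carrier} (hf : Compatible V V f)
    (n : ℕ) : Compatible V V (f ^ n) := by
  induction n with
  | zero => exact fun s x hx => hx
  | succ n ih => rw [pow_succ']; exact Compatible.comp hf ih

/-- An isomorphism of `S`-spaces in terms of linear equivalences. -/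
def Equivalent (U V : SSpace k S) : Prop :=
  ∃ e : U.carrier ≃ₗ[k] V.carrier, ∀ s x, e x ∈ V.sub s ↔ x ∈ U.sub s

theorem nonempty_iso_iff {U V : SSpace k S} : Nonempty (U ≅ V) ↔ Equivalent U V := by
  constructor
  · rintro ⟨i⟩
    have h1 : ∀ x, i.inv.toLin (i.hom.toLin x) = x := fun x =>
      LinearMap.congr_fun (congrArg Hom.toLin i.hom_inv_id) x
    have h2 : ∀ x, i.hom.toLin (i.inv.toLin x) = x := fun x =>
      LinearMap.congr_fun (congrArg Hom.toLin i.inv_hom_id) x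
    refine ⟨LinearEquiv.ofLinearMap i.hom.toLin i.inv.toLin (LinearMap.ext h2) (LinearMap.ext h1),
      fun s x => ⟨fun hx => ?_, fun hx => ?_⟩⟩
    · have := i.inv.map_sub_le s (Submodule.mem_map_of_mem hx)
      simpa [h1] using this
    · exact i.hom.map_sub_le s (Submodule.mem_map_of_mem hx)
  · rintro ⟨e, he⟩
    refine ⟨⟨⟨e.toLinearMap, fun s => ?_⟩, ⟨e.symm.toLinearMap, fun s => ?_⟩, ?_, ?_⟩⟩
    · rintro _ ⟨x, hx, rfl⟩
      exact (he s x).2 hx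
    · rintro _ ⟨x, hx, rfl⟩
      exact (he s _).1 (by simpa using hx)
    · exact Hom.ext (LinearMap.ext fun x => e.symm_apply_apply x)
    · exact Hom.ext (LinearMap.ext fun x => e.apply_symm_apply x)

theorem Equivalent.symm {U V : SSpace k S} (h : Equivalent U V) : Equivalent V U :=
  nonempty_iso_iff.1 ((nonempty_iso_iff.2 h).map Iso.symm)

theorem Equivalent.trans {U V W : SSpace k S} (h : Equivalent U V) (h' : Equivalent V W) :
    Equivalent U W := by
  obtain ⟨e, he⟩ := h
  obtain ⟨e', he'⟩ := h'
  exact ⟨e.trans e', fun s x => (he' s _).trans (he s x)⟩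

/-- The `S`-space induced on a subspace of the ambient space. -/
def restrict (V : SSpace k S) (N : Submodule k V.carrier) : SSpace k S where
  carrier := N
  sub s := (V.sub s).comap N.subtype
  sub_mono s t h := Submodule.comap_mono (V.sub_mono s t h)

theorem equivalent_directSum_of_idempotent {V : SSpace k S} {e : Module.End k V.carrier}
    (he : Compatible V V e) (hi : IsIdempotentElem e) :
    Equivalent V (directSum (V.restrict (LinearMap.range e)) (V.restrict (LinearMap.ker e))) := by
  have hee : ∀ x, e (e x) = e x := fun x => LinearMap.congr_fun hi x
  refine Equivalent.symm ⟨Submodule.prodEquivOfIsCompl _ _ (LinearMap.IsIdempotentElem.isCompl hi),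
    fun s x => ?_⟩
  obtain ⟨⟨a, ha⟩, ⟨b, hb⟩⟩ := x
  have hea : e a = a := by
    obtain ⟨y, rfl⟩ := ha
    exact hee y
  have heb : e b = 0 := hb
  have : Submodule.prodEquivOfIsCompl _ _ (LinearMap.IsIdempotentElem.isCompl hi)
      ((⟨a, ha⟩, ⟨b, hb⟩) : LinearMap.range e × LinearMap.ker e) = a + b := by
    simp
  refine Iff.trans (b := a + b ∈ V.sub s) (by rw [← this]; rfl) ?_
  change _ ↔ a ∈ V.sub s ∧ b ∈ V.sub s
  refine ⟨fun h => ?_, fun h => Submodule.add_mem _ h.1 h.2⟩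
  have h1 : a ∈ V.sub s := by simpa [hea, heb] using he s _ h
  exact ⟨h1, (Submodule.add_mem_iff_right _ h1).1 h⟩

/-- Direct decompositions correspond to compatible idempotents: range and kernel in one direction,
projection to a factor in the other. -/
theorem isIndecomposable_iff (V : SSpace k S) :
    V.IsIndecomposable ↔ Nontrivial V.carrier ∧ ∀ e : Module.End k V.carrier,
      Compatible V V e → IsIdempotentElem e → e = 0 ∨ e = 1 := by
  unfold IsIndecomposable
  refine and_congr not_subsingleton_iff_nontrivial ⟨fun h e he hi => ?_, fun h U W hUW => ?_⟩
  · have hee : ∀ x, e (e x) = e x := fun x => LinearMap.congr_fun hi x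
    rcases h _ _ (nonempty_iso_iff.2 (equivalent_directSum_of_idempotent he hi)) with h0 | h0
    · left
      have h0 : Subsingleton (LinearMap.range e) := h0
      rw [Submodule.subsingleton_iff_eq_bot, LinearMap.range_eq_bot] at h0
      exact h0
    · right
      have h0 : Subsingleton (LinearMap.ker e) := h0
      rw [Submodule.subsingleton_iff_eq_bot, LinearMap.ker_eq_bot] at h0
      exact LinearMap.ext fun x => h0 (hee x)
  · obtain ⟨i, hi⟩ := nonempty_iso_iff.1 hUW
    let i' : V.carrier ≃ₗ[k] U.carrier × W.carrier := i
    let e : Module.End k V.carrier := i'.symm.toLinearMap ∘ₗ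
      (LinearMap.inl k _ _ ∘ₗ LinearMap.fst k _ _) ∘ₗ i'.toLinearMap
    have hie : ∀ x, i' (e x) = ((i' x).1, 0) := fun x => i'.apply_symm_apply _
    have he : Compatible V V e := fun s x hx => by
      refine (hi s _).1 ?_
      have h1 : (i' x).1 ∈ U.sub s ∧ (i' x).2 ∈ W.sub s := (hi s x).2 hx
      change i' (e x) ∈ (U.sub s).prod (W.sub s)
      rw [hie]
      exact ⟨h1.1, Submodule.zero_mem _⟩
    have hidem : IsIdempotentElem e := LinearMap.ext fun x => i'.injective (by
      rw [Module.End.mul_apply, hie, hie])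
    rcases h e he hidem with h0 | h0
    · left
      refine ⟨fun a b => ?_⟩
      have := hie (i'.symm (a - b, 0))
      rw [h0] at this
      simp only [LinearMap.zero_apply, map_zero, LinearEquiv.apply_symm_apply] at this
      exact sub_eq_zero.1 (congrArg Prod.fst this).symm
    · right
      refine ⟨fun a b => ?_⟩
      have := hie (i'.symm (0, a - b))
      rw [h0] at this
      simp only [Module.End.one_apply, LinearEquiv.apply_symm_apply] at this
      exact sub_eq_zero.1 (congrArg Prod.snd this)

theorem Equivalent.isIndecomposable {U V : SSpace k S} (h : Equivalent U V)
    (hU : U.IsIndecomposable) : V.IsIndecomposable := by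
  obtain ⟨e, he⟩ := id h
  refine ⟨fun h0 => hU.1 ?_, fun A B hAB => hU.2 A B ?_⟩
  · have : Subsingleton V.carrier := h0
    exact e.toEquiv.subsingleton
  · exact nonempty_iso_iff.2 (h.trans (nonempty_iso_iff.1 hAB))

/-- By finite dimension, an injective `f` carries `V(s)` onto itself, so it also reflects
membership. -/
theorem Compatible.mem_iff_of_injective {V : SSpace k S} {f : Module.End k V.carrier}
    (hf : Compatible V V f) (hinj : Function.Injective f) (s : S) (x : V.carrier) :
    f x ∈ V.sub s ↔ x ∈ V.sub s := by
  refine ⟨fun h => ?_, hf s x⟩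
  have hle : (V.sub s).map f ≤ V.sub s := by
    rintro _ ⟨y, hy, rfl⟩
    exact hf s y hy
  have heq := Submodule.eq_of_le_of_finrank_eq hle (by
    rw [← LinearMap.range_domRestrict]
    exact LinearMap.finrank_range_of_inj (hinj.comp Subtype.val_injective))
  rw [← heq] at h
  obtain ⟨y, hy, hyx⟩ := h
  exact hinj hyx ▸ hy

/-- Fitting's lemma for `S`-spaces. -/
theorem IsIndecomposable.isNilpotent_or_injective {V : SSpace k S} (hV : V.IsIndecomposable)
    {f : Module.End k V.carrier} (hf : Compatible V V f) :
    IsNilpotent f ∨ Function.Injective f := by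
  -- The bound `n ≥ 1` is used at the end: injectivity of `f ^ 0` would say nothing about `f`.
  obtain ⟨n, hn, hn1⟩ := (f.eventually_isCompl_ker_pow_range_pow.and
    (Filter.eventually_ge_atTop 1)).exists
  have hc := hn.symm
  set e := (LinearMap.range (f ^ n)).projection _ hc with he
  have hidem : IsIdempotentElem e := LinearMap.ext fun x =>
    Submodule.projection_apply_of_mem_left hc (Submodule.projection_apply_mem hc x)
  -- `f ^ n` is bijective on `V(s) ∩ range (f ^ n)`, so for `x ∈ V(s)` some `y` there has `f ^ n y =
  -- f ^ n x`. Then `x - y` lies in the kernel and `e x = y ∈ V(s)`.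
  have hcomp : Compatible V V e := by
    intro s x hx
    have hle : (V.sub s ⊓ LinearMap.range (f ^ n)).map (f ^ n) ≤
        V.sub s ⊓ LinearMap.range (f ^ n) := by
      rintro _ ⟨y, hy, rfl⟩
      exact ⟨hf.pow n s y hy.1, y, rfl⟩
    have hinj : Function.Injective ((f ^ n).domRestrict (V.sub s ⊓ LinearMap.range (f ^ n))) := by
      rw [← LinearMap.ker_eq_bot, LinearMap.ker_eq_bot']
      rintro ⟨y, hy⟩ hy0
      have : y ∈ LinearMap.ker (f ^ n) ⊓ LinearMap.range (f ^ n) := ⟨hy0, hy.2⟩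
      rw [hn.inf_eq_bot] at this
      exact Subtype.ext this
    have heq := Submodule.eq_of_le_of_finrank_eq hle (by
      rw [← LinearMap.range_domRestrict]
      exact LinearMap.finrank_range_of_inj hinj)
    have hfx : (f ^ n) x ∈ V.sub s ⊓ LinearMap.range (f ^ n) := ⟨hf.pow n s x hx, x, rfl⟩
    rw [← heq] at hfx
    obtain ⟨y, hy, hyx⟩ := hfx
    have hk : x - y ∈ LinearMap.ker (f ^ n) := by
      rw [LinearMap.mem_ker, map_sub, hyx, sub_self]
    have h1 : e (x - y) = 0 := Submodule.projection_apply_of_mem_right hc hk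
    have h2 : e y = y := Submodule.projection_apply_of_mem_left hc hy.2
    rw [map_sub, h2, sub_eq_zero] at h1
    rw [h1]
    exact hy.1
  rcases ((isIndecomposable_iff V).1 hV).2 e hcomp hidem with h0 | h0
  · left
    refine ⟨n, ?_⟩
    rw [← LinearMap.range_eq_bot, ← Submodule.range_projection hc, ← he, h0, LinearMap.range_zero]
  · right
    have : LinearMap.ker (f ^ n) = ⊥ := by
      rw [← Submodule.ker_projection hc, ← he, h0]
      exact LinearMap.ker_id
    rw [← LinearMap.ker_eq_bot, eq_bot_iff, ← this]
    obtain ⟨m, rfl⟩ := Nat.exists_eq_add_of_le' hn1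
    intro x hx
    rw [LinearMap.mem_ker, pow_succ, Module.End.mul_apply, LinearMap.mem_ker.1 hx, map_zero]

end SSpace

/-! ### Families of subspaces over posets of width at most two -/

theorem comparable_of_posetWidth_le_two {X : Type v} [PartialOrder X] (hw : posetWidth X ≤ 2)
    {x y z : X} (hxy : ¬ x ≤ y) (hyx : ¬ y ≤ x) (hxz : ¬ x ≤ z) (hzx : ¬ z ≤ x) :
    y ≤ z ∨ z ≤ y := by
  by_contra! h
  have hA : IsAntichain (· ≤ ·) ({x, y, z} : Set X) := by
    rintro a (rfl | rfl | rfl) b (rfl | rfl | rfl) hab <;>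
      first | exact absurd rfl hab | assumption | exact h.1 | exact h.2
  have h3 : ({x, y, z} : Set X).encard ≤ 2 :=
    (le_iSup (fun A : {A : Set X // IsAntichain (· ≤ ·) A} => A.1.encard) ⟨_, hA⟩).trans hw
  rw [Set.encard_eq_three.2 ⟨x, y, z, fun e => hxy e.le, fun e => hxz e.le,
    fun e => h.1 e.le, rfl⟩] at h3
  exact absurd h3 (by decide)

section Splitting

variable {k : Type u} [Field k] {X : Type v} [PartialOrder X] [Finite X]

/-- A monotone family of subspaces indexed by a poset of width at most two has a
one-dimensional direct summand. -/
theorem exists_line_splitting (hw : posetWidth X ≤ 2) {E : Type u} [AddCommGroup E] [Module k E]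
    [Nontrivial E] {V : X → Submodule k E} (hV : Monotone V) :
    ∃ (v : E) (φ : E →ₗ[k] k), φ v = 1 ∧ ∀ x, v ∈ V x ∨ V x ≤ LinearMap.ker φ := by
  suffices h : ∃ (v : E) (J : Submodule k E), v ∉ J ∧ ∀ x, v ∈ V x ∨ V x ≤ J by
    obtain ⟨v, J, hv, hJ⟩ := h
    obtain ⟨φ, hφ, hle⟩ := Submodule.exists_le_ker_of_notMem hv
    refine ⟨v, (φ v)⁻¹ • φ, inv_mul_cancel₀ hφ, fun x => (hJ x).imp_right fun h y hy => ?_⟩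
    have : φ y = 0 := hle (h hy)
    simp [this]
  rcases Set.eq_empty_or_nonempty {x | V x ≠ ⊥} with hY | hY
  · obtain ⟨v, hv⟩ := exists_ne (0 : E)
    refine ⟨v, ⊥, hv, fun x => Or.inr ?_⟩
    by_contra hx
    exact (Set.ext_iff.1 hY x).1 fun h => hx h.le
  obtain ⟨a, ha, hmin⟩ := (Set.toFinite _).exists_minimal hY
  -- By minimality of `a`, every `c` with `V c ≠ ⊥` not above `a` is incomparable to `a`, so these
  -- `c` form a chain. `J` is the largest `V c` meeting `V a` trivially; `I` is the smallest nonzero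
  -- `V a ⊓ V c`. Any nonzero `v ∈ I` works.
  have hchain : ∀ c c', V c ≠ ⊥ → V c' ≠ ⊥ → ¬ a ≤ c → ¬ a ≤ c' → c ≤ c' ∨ c' ≤ c :=
    fun c c' hc hc' h h' => comparable_of_posetWidth_le_two hw h (fun hle => h (hmin hc hle)) h'
      (fun hle => h' (hmin hc' hle))
  have hJ : ∃ J, V a ⊓ J = ⊥ ∧ ∀ c, V c ≠ ⊥ → ¬ a ≤ c → V a ⊓ V c = ⊥ → V c ≤ J := by
    rcases Set.eq_empty_or_nonempty {c | V c ≠ ⊥ ∧ ¬ a ≤ c ∧ V a ⊓ V c = ⊥} with h0 | h0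
    · exact ⟨⊥, inf_bot_eq _, fun c h1 h2 h3 => ((Set.ext_iff.1 h0 c).1 ⟨h1, h2, h3⟩).elim⟩
    · obtain ⟨m, hm, hmax⟩ := (Set.toFinite _).exists_maximal h0
      refine ⟨V m, hm.2.2, fun c h1 h2 h3 => hV ?_⟩
      exact (hchain c m h1 hm.1 h2 hm.2.1).elim id fun h => hmax ⟨h1, h2, h3⟩ h
  have hI : ∃ I, I ≠ ⊥ ∧ I ≤ V a ∧ ∀ c, V c ≠ ⊥ → ¬ a ≤ c → V a ⊓ V c ≠ ⊥ → I ≤ V c := by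
    rcases Set.eq_empty_or_nonempty {c | V c ≠ ⊥ ∧ ¬ a ≤ c ∧ V a ⊓ V c ≠ ⊥} with h0 | h0
    · exact ⟨V a, ha, le_rfl, fun c h1 h2 h3 => ((Set.ext_iff.1 h0 c).1 ⟨h1, h2, h3⟩).elim⟩
    · obtain ⟨m, hm, hmin'⟩ := (Set.toFinite _).exists_minimal h0
      refine ⟨V a ⊓ V m, hm.2.2, inf_le_left, fun c h1 h2 h3 => inf_le_right.trans (hV ?_)⟩
      exact (hchain m c hm.1 h1 hm.2.1 h2).elim id fun h => hmin' ⟨h1, h2, h3⟩ h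
  obtain ⟨J, hJa, hJ⟩ := hJ
  obtain ⟨I, hI0, hIa, hI⟩ := hI
  obtain ⟨v, hv, hv0⟩ := Submodule.exists_mem_ne_zero_of_ne_bot hI0
  refine ⟨v, J, fun hvJ => hv0 ?_, fun x => ?_⟩
  · have : v ∈ V a ⊓ J := ⟨hIa hv, hvJ⟩
    rwa [hJa] at this
  · by_cases hx : V x = ⊥
    · exact Or.inr (hx ▸ bot_le)
    by_cases hax : a ≤ x
    · exact Or.inl (hV hax (hIa hv))
    by_cases h : V a ⊓ V x = ⊥
    · exact Or.inr (hJ x hx hax h)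
    · exact Or.inl (hI x hx hax h hv)

/-- Spaces with a monotone family of subspaces indexed by a poset of width at most two are
projective with respect to maps along which every vector lifts compatibly. -/
theorem exists_compatible_lift (hw : posetWidth X ≤ 2) {E' W : Type u} [AddCommGroup E']
    [Module k E'] [AddCommGroup W] [Module k W] (q : E' →ₗ[k] W) (V' : X → Submodule k E')
    (n : ℕ) : ∀ {E : Type u} [AddCommGroup E] [Module k E] [FiniteDimensional k E],
    Module.finrank k E = n → ∀ {V : X → Submodule k E}, Monotone V → ∀ h : E →ₗ[k] W,
    (∀ v, ∃ y, q y = h v ∧ ∀ x, v ∈ V x → y ∈ V' x) →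
    ∃ g : E →ₗ[k] E', (∀ v, q (g v) = h v) ∧ ∀ x, ∀ v ∈ V x, g v ∈ V' x := by
  induction n with
  | zero =>
    intro E _ _ _ hn V _ h _
    have := Module.finrank_zero_iff.1 hn
    refine ⟨0, fun v => ?_, fun x v _ => Submodule.zero_mem _⟩
    rw [Subsingleton.elim v 0]
    simp
  | succ n ih =>
    intro E _ _ _ hn V hV h hlift
    have : Nontrivial E := Module.nontrivial_of_finrank_pos (R := k) (by omega)
    obtain ⟨v, φ, hφ, hv⟩ := exists_line_splitting hw hV
    have hker : Module.finrank k (LinearMap.ker φ) = n := by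
      have h1 := φ.finrank_range_add_finrank_ker
      have h2 : LinearMap.range φ = ⊤ := LinearMap.range_eq_top.2 fun c =>
        ⟨c • v, by simp [hφ]⟩
      rw [h2, finrank_top, Module.finrank_self] at h1
      omega
    obtain ⟨g, hg, hgV⟩ := ih hker (V := fun x => (V x).comap (LinearMap.ker φ).subtype)
      (fun x y hxy => Submodule.comap_mono (hV hxy)) (h ∘ₗ (LinearMap.ker φ).subtype)
      (fun w => hlift w)
    obtain ⟨y, hy, hyV⟩ := hlift v
    -- The projection to `ker φ` along `v`. It preserves each `V x`: either `v ∈ V x`, or `φ`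
    -- vanishes on `V x`.
    let π : E →ₗ[k] LinearMap.ker φ := (LinearMap.id - φ.smulRight v).codRestrict _ fun w => by
      simp [hφ]
    have hπ : ∀ w, (π w : E) = w - φ w • v := fun w => rfl
    refine ⟨g ∘ₗ π + φ.smulRight y, fun w => ?_, fun x w hw' => ?_⟩
    · simp [hg, hπ, hy]
    · rcases hv x with hvx | hvx
      · exact Submodule.add_mem _
          (hgV x _ (Submodule.sub_mem _ hw' (Submodule.smul_mem _ _ hvx)))
          (Submodule.smul_mem _ _ (hyV x hvx))
      · have h0 : φ w = 0 := hvx hw'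
        refine Submodule.add_mem _ (hgV x _ ?_) ?_
        · change (π w : E) ∈ V x
          rw [hπ, h0, zero_smul, sub_zero]
          exact hw'
        · simp [h0]

end Splitting

/-! ### The derivative and its fullness -/

namespace SSpace

variable {k : Type u} [Field k] {S : Type v} [PartialOrder S]

theorem equivalent_of_inverse {U V : SSpace k S} {f : U.carrier →ₗ[k] V.carrier}
    {g : V.carrier →ₗ[k] U.carrier} (hf : Compatible U V f) (hg : Compatible V U g)
    (hgf : ∀ x, g (f x) = x) (hfg : ∀ x, f (g x) = x) : Equivalent U V :=
  ⟨LinearEquiv.ofLinearMap f g (LinearMap.ext hfg) (LinearMap.ext hgf),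
    fun s x => ⟨fun h => hgf x ▸ hg s _ h, hf s x⟩⟩

/-- The derivative of an `S`-space with respect to the principal filter `⟨p⟩`. -/
def derive (p : S) (V : SSpace k S) : SSpace k (derivedPoset p) where
  carrier := V.carrier ⧸ V.sub p
  sub A := (⨅ a ∈ A.1.carrier, V.sub a).map (V.sub p).mkQ
  sub_mono A B h := Submodule.map_mono <| le_iInf₂ fun b hb => by
    obtain ⟨a, ha, hab⟩ := h b hb
    exact (iInf₂_le a ha).trans (V.sub_mono a b hab)

/-- The projection of the ambient space of an `S`-space to that of its derivative. -/
def toDerive (p : S) (V : SSpace k S) : V.carrier →ₗ[k] (derive p V).carrier :=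
  (V.sub p).mkQ

theorem toDerive_surjective (p : S) (V : SSpace k S) : Function.Surjective (toDerive p V) :=
  Submodule.mkQ_surjective _

theorem toDerive_eq_zero_iff {p : S} {V : SSpace k S} {x : V.carrier} :
    toDerive p V x = 0 ↔ x ∈ V.sub p :=
  Submodule.Quotient.mk_eq_zero _

theorem mem_derive_sub_iff {p : S} {V : SSpace k S} {A : derivedPoset p}
    {x : (derive p V).carrier} :
    x ∈ (derive p V).sub A ↔ ∃ v, (∀ a ∈ A.1.carrier, v ∈ V.sub a) ∧ toDerive p V v = x := by
  change (∃ v, v ∈ (⨅ a ∈ A.1.carrier, V.sub a) ∧ toDerive p V v = x) ↔ _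
  simp only [Submodule.mem_iInf]

section Map

variable {U V : SSpace k S} {p : S}

/-- The map induced on derivatives. -/
def deriveMap (p : S) {f : U.carrier →ₗ[k] V.carrier} (hf : Compatible U V f) :
    (derive p U).carrier →ₗ[k] (derive p V).carrier :=
  Submodule.mapQ _ _ f (hf p)

theorem deriveMap_toDerive {f : U.carrier →ₗ[k] V.carrier} (hf : Compatible U V f)
    (x : U.carrier) : deriveMap p hf (toDerive p U x) = toDerive p V (f x) :=
  rfl

theorem compatible_deriveMap {f : U.carrier →ₗ[k] V.carrier} (hf : Compatible U V f) :
    Compatible (derive p U) (derive p V) (deriveMap p hf) := by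
  intro A x hx
  obtain ⟨v, hv, rfl⟩ := mem_derive_sub_iff.1 hx
  exact mem_derive_sub_iff.2 ⟨f v, fun a ha => hf a v (hv a ha), rfl⟩

theorem Equivalent.derive (h : Equivalent U V) (p : S) :
    Equivalent (derive p U) (derive p V) := by
  obtain ⟨e, he⟩ := h
  have h1 : Compatible U V e.toLinearMap := fun s x hx => (he s x).2 hx
  have h2 : Compatible V U e.symm.toLinearMap := fun s x hx => (he s _).1 (by simpa using hx)
  refine equivalent_of_inverse (compatible_deriveMap h1) (compatible_deriveMap h2)
    (fun x => ?_) (fun x => ?_)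
  · obtain ⟨v, rfl⟩ := toDerive_surjective p U x
    simp [deriveMap_toDerive]
  · obtain ⟨v, rfl⟩ := toDerive_surjective p V x
    simp [deriveMap_toDerive]

end Map

/-- Differentiation is full. -/
theorem exists_compatible_of_derive [Finite S] {p : S} (hw : posetWidth ↥((Set.Ici p)ᶜ) ≤ 2)
    {U V : SSpace k S} {f : (derive p U).carrier →ₗ[k] (derive p V).carrier}
    (hf : Compatible (derive p U) (derive p V) f) :
    ∃ g, Compatible U V g ∧ ∀ v, toDerive p V (g v) = f (toDerive p U v) := by
  have hlift : ∀ v, ∃ y, toDerive p V y = (f ∘ₗ toDerive p U) v ∧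
      ∀ x : ↥((Set.Ici p)ᶜ), v ∈ U.sub x → y ∈ V.sub x := by
    intro v
    rcases Set.eq_empty_or_nonempty {s | ¬ p ≤ s ∧ v ∈ U.sub s} with h0 | h0
    · obtain ⟨y, hy⟩ := toDerive_surjective p V (f (toDerive p U v))
      exact ⟨y, hy, fun x hx => ((Set.ext_iff.1 h0 x.1).1 ⟨x.2, hx⟩).elim⟩
    · have hmin : ∀ s ∈ {s | ¬ p ≤ s ∧ v ∈ U.sub s}, ∃ a ≤ s,
          Minimal (· ∈ {s | ¬ p ≤ s ∧ v ∈ U.sub s}) a := fun s hs =>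
        (Set.toFinite _).exists_le_minimal hs
      -- The minimal `s` outside `⟨p⟩` with `v ∈ U(s)`: lifting inside all `V(a)`, `a ∈ A`, suffices
      -- by monotonicity. If `A ≤ p`, then `v ∈ U(p)` and `0` is a lift; otherwise `A ∈ S_p`.
      let A : AntichainHat S := ⟨{a | Minimal (· ∈ {s | ¬ p ≤ s ∧ v ∈ U.sub s}) a},
        setOfPred_minimal_antichain _, by
          obtain ⟨s, hs⟩ := h0
          obtain ⟨a, -, ha⟩ := hmin s hs
          exact ⟨a, ha⟩⟩
      by_cases hA : A ≤ AntichainHat.single p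
      · obtain ⟨a, ha, hap⟩ := hA p rfl
        have h1 := toDerive_eq_zero_iff.2 (U.sub_mono _ _ hap ha.1.2)
        refine ⟨0, ?_, fun x _ => Submodule.zero_mem _⟩
        rw [LinearMap.comp_apply, h1, map_zero, map_zero]
      · have hAD : A ∈ derivedPoset p := ⟨Or.inr fun a ha => ha.1.1, hA⟩
        have := hf ⟨A, hAD⟩ _ (mem_derive_sub_iff.2 ⟨v, fun a ha => ha.1.2, rfl⟩)
        obtain ⟨y, hy, hyx⟩ := mem_derive_sub_iff.1 this
        refine ⟨y, hyx, fun x hx => ?_⟩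
        obtain ⟨a, hax, ha⟩ := hmin x.1 ⟨x.2, hx⟩
        exact V.sub_mono _ _ hax (hy a ha)
  obtain ⟨g, hg, hgX⟩ := exists_compatible_lift hw (toDerive p V)
    (fun x : ↥((Set.Ici p)ᶜ) => V.sub x) _ (E := U.carrier) rfl
    (V := fun x : ↥((Set.Ici p)ᶜ) => U.sub x) (fun x y h => U.sub_mono x y h)
    (f ∘ₗ toDerive p U) hlift
  refine ⟨g, fun s x hx => ?_, hg⟩
  -- On `⟨p⟩` compatibility is automatic: `g x` differs from an element of `V(s)` by one of `V(p) ⊆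
  -- V(s)`.
  by_cases hs : p ≤ s
  · rcases hs.eq_or_lt with rfl | hs
    · rw [← toDerive_eq_zero_iff, hg, LinearMap.comp_apply, toDerive_eq_zero_iff.2 hx, map_zero]
    · have hA : AntichainHat.single s ∈ derivedPoset p := by
        refine ⟨Or.inl ⟨s, hs.le, rfl⟩, fun hle => ?_⟩
        obtain ⟨a, rfl, hap⟩ := hle p rfl
        exact hs.not_ge hap
      have := hf ⟨_, hA⟩ _ (mem_derive_sub_iff.2 ⟨x, fun a ha => by
        obtain rfl := Set.mem_singleton_iff.1 ha
        exact hx, rfl⟩)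
      obtain ⟨y, hy, hyx⟩ := mem_derive_sub_iff.1 this
      have hxy : toDerive p V (g x - y) = 0 := by
        rw [map_sub, hyx, hg, LinearMap.comp_apply, sub_self]
      have h1 := V.sub_mono _ _ hs.le (toDerive_eq_zero_iff.1 hxy)
      simpa using Submodule.add_mem _ h1 (hy s rfl)
  · exact hgX ⟨s, hs⟩ x hx

/-! ### Integration -/

section Integrate

variable {p : S} {m : ℕ} (σ : derivedPoset p ≃ Fin m)

/-- The sum map `W × Wⁿ → W`. -/
def sumMap (k W : Type u) [Field k] [AddCommGroup W] [Module k W] (n : ℕ) :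
    W × (Fin n → W) →ₗ[k] W :=
  LinearMap.coprod LinearMap.id (∑ i, LinearMap.proj i)

theorem sumMap_apply {k W : Type u} [Field k] [AddCommGroup W] [Module k W] {n : ℕ}
    (x : W × (Fin n → W)) : sumMap k W n x = x.1 + ∑ i, x.2 i := by
  simp [sumMap]

/-- The subspace of `W × Wⁿ` attached to an element outside the filter `⟨p⟩`. -/
def integrateSub (W : SSpace k (derivedPoset p)) (s : S) :
    Submodule k (W.carrier × (Fin m → W.carrier)) where
  carrier := {x | x.1 = 0 ∧ ∀ A : derivedPoset p, x.2 (σ A) ∈ W.sub A ∧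
    (¬ A.1 ≤ AntichainHat.single s → x.2 (σ A) = 0)}
  zero_mem' := ⟨rfl, fun A => ⟨Submodule.zero_mem _, fun _ => rfl⟩⟩
  add_mem' {x y} hx hy := ⟨by simp [hx.1, hy.1], fun A =>
    ⟨Submodule.add_mem _ (hx.2 A).1 (hy.2 A).1, fun h => by
      simp [(hx.2 A).2 h, (hy.2 A).2 h]⟩⟩
  smul_mem' c x hx := ⟨by simp [hx.1], fun A =>
    ⟨Submodule.smul_mem _ c (hx.2 A).1, fun h => by simp [(hx.2 A).2 h]⟩⟩

theorem single_le_single {s t : S} (h : s ≤ t) :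
    AntichainHat.single s ≤ AntichainHat.single t := by
  rintro _ rfl
  exact ⟨s, rfl, h⟩

theorem sumMap_mem_of_mem_integrateSub {W : SSpace k (derivedPoset p)} {N : Submodule k W.carrier}
    {x : W.carrier × (Fin m → W.carrier)} (h0 : x.1 = 0)
    (h : ∀ A : derivedPoset p, x.2 (σ A) ∈ N) : sumMap k W.carrier _ x ∈ N := by
  rw [sumMap_apply, h0, zero_add]
  refine Submodule.sum_mem _ fun i _ => ?_
  simpa using h (σ.symm i)

open Classical in
/-- An `S`-space whose derivative is the given space. -/
noncomputable def integrate (W : SSpace k (derivedPoset p)) : SSpace k S where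
  -- A free copy of `W`, which makes the sum map surjective, and one copy for each `A ∈ S_p`.
  -- Indexing by `Fin m` keeps the space in universe `u`, whereas `S` lives in `v`.
  carrier := W.carrier × (Fin m → W.carrier)
  sub s := if p ≤ s then (⨆ A : derivedPoset p, ⨆ _ : A.1 ≤ AntichainHat.single s,
    W.sub A).comap (sumMap k W.carrier _) else integrateSub σ W s
  sub_mono s t h := by
    by_cases hs : p ≤ s
    · rw [if_pos hs, if_pos (hs.trans h)]
      exact Submodule.comap_mono <| iSup₂_le fun A hA =>
        le_iSup₂_of_le A (hA.trans (single_le_single h)) le_rfl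
    rw [if_neg hs]
    rintro x ⟨h0, hx⟩
    by_cases ht : p ≤ t
    · rw [if_pos ht]
      refine Submodule.mem_comap.2 (sumMap_mem_of_mem_integrateSub σ h0 fun A => ?_)
      by_cases hA : A.1 ≤ AntichainHat.single s
      · exact Submodule.mem_iSup_of_mem A
          (Submodule.mem_iSup_of_mem (hA.trans (single_le_single h)) (hx A).1)
      · rw [(hx A).2 hA]
        exact Submodule.zero_mem _
    · rw [if_neg ht]
      exact ⟨h0, fun A => ⟨(hx A).1, fun hA => (hx A).2 fun hle =>
        hA (hle.trans (single_le_single h))⟩⟩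

theorem mem_integrate_sub_of_le {W : SSpace k (derivedPoset p)} {s : S} (hs : p ≤ s)
    {x : (integrate σ W).carrier} : x ∈ (integrate σ W).sub s ↔
      sumMap k W.carrier _ x ∈ ⨆ A : derivedPoset p, ⨆ _ : A.1 ≤ AntichainHat.single s,
        W.sub A := by
  simp only [integrate, if_pos hs]
  rfl

theorem mem_integrate_sub_of_not_le {W : SSpace k (derivedPoset p)} {s : S} (hs : ¬ p ≤ s)
    {x : (integrate σ W).carrier} : x ∈ (integrate σ W).sub s ↔ x ∈ integrateSub σ W s := by
  simp only [integrate, if_neg hs]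
  rfl

/-- Differentiation is dense. -/
theorem equivalent_derive_integrate (W : SSpace k (derivedPoset p)) :
    Equivalent (derive p (integrate σ W)) W := by
  let π : (integrate σ W).carrier →ₗ[k] W.carrier := sumMap k W.carrier _
  have hπ : Function.Surjective π := fun w => ⟨(w, 0), by
    change sumMap k W.carrier _ (w, 0) = w
    simp [sumMap_apply]⟩
  -- No `A ∈ S_p` lies below `p`, so the supremum defining the subspace at `p` is zero.
  have hker : (integrate σ W).sub p = LinearMap.ker π := by
    ext x
    rw [mem_integrate_sub_of_le σ le_rfl]
    have : (⨆ A : derivedPoset p, ⨆ _ : A.1 ≤ AntichainHat.single p, W.sub A) = ⊥ := by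
      simp only [iSup_eq_bot]
      exact fun A hA => absurd hA A.2.2
    rw [this]
    rfl
  let e : (derive p (integrate σ W)).carrier ≃ₗ[k] W.carrier :=
    (Submodule.quotEquivOfEq _ _ hker).trans (π.quotKerEquivOfSurjective hπ)
  have he : ∀ x, e (toDerive p _ x) = π x := fun x => rfl
  have hsum : ∀ A : derivedPoset p, ∀ x : (integrate σ W).carrier,
      (∀ a ∈ A.1.carrier, x ∈ (integrate σ W).sub a) → π x ∈ W.sub A := by
    intro A x hx
    rcases A.2.1 with ⟨s, hs, hsA⟩ | hA
    · have h1 := (mem_integrate_sub_of_le σ hs).1 (hx s (by rw [← hsA]; rfl))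
      refine (iSup₂_le fun B hB => ?_ : _ ≤ W.sub A) h1
      exact W.sub_mono _ _ (by rw [hsA] at hB; exact hB)
    · have hx' := fun a ha => (mem_integrate_sub_of_not_le σ (hA ha)).1 (hx a ha)
      obtain ⟨a, ha⟩ := A.1.nonempty
      refine sumMap_mem_of_mem_integrateSub σ (hx' a ha).1 fun B => ?_
      -- `B ≤ {a}` for all `a ∈ A` means `B ≤ A`, so only coordinates in some `W(B) ⊆ W(A)` survive.
      by_cases hB : B.1 ≤ A.1
      · exact W.sub_mono _ _ hB ((hx' a ha).2 B).1
      · have : ∃ b ∈ A.1.carrier, ¬ B.1 ≤ AntichainHat.single b := by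
          by_contra! h
          exact hB fun b hb => h b hb b rfl
        obtain ⟨b, hb, hBb⟩ := this
        rw [((hx' b hb).2 B).2 hBb]
        exact Submodule.zero_mem _
  have hlift : ∀ A : derivedPoset p, ∀ x : (integrate σ W).carrier, π x ∈ W.sub A →
      ∃ z, (∀ a ∈ A.1.carrier, z ∈ (integrate σ W).sub a) ∧ π z = π x := by
    classical
    intro A x hx
    rcases A.2.1 with ⟨s, hs, hsA⟩ | hA
    · refine ⟨x, fun a ha => ?_, rfl⟩
      rw [← hsA] at ha
      obtain rfl := Set.mem_singleton_iff.1 ha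
      rw [mem_integrate_sub_of_le σ hs]
      exact Submodule.mem_iSup_of_mem A (Submodule.mem_iSup_of_mem hsA.ge hx)
    · refine ⟨((0 : W.carrier), Pi.single (σ A) (π x)), fun a ha => ?_, ?_⟩
      · refine (mem_integrate_sub_of_not_le σ (hA ha)).2 ?_
        refine ⟨rfl, fun B => ?_⟩
        by_cases hBA : B = A
        · subst hBA
          refine ⟨by simpa using hx, fun h => absurd ?_ h⟩
          rintro _ rfl
          exact ⟨_, ha, le_rfl⟩
        · have : (Pi.single (σ A) (π x) : Fin _ → W.carrier) (σ B) = 0 :=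
            Pi.single_eq_of_ne (fun h => hBA (σ.injective h)) _
          exact ⟨by simp only [this, Submodule.zero_mem], fun _ => this⟩
      · change sumMap k W.carrier _ (_, _) = _
        simp [sumMap_apply]
  refine ⟨e, fun A x => ⟨fun hx => ?_, fun hx => ?_⟩⟩
  · obtain ⟨y, rfl⟩ := toDerive_surjective p _ x
    rw [he] at hx
    obtain ⟨z, hz, hzy⟩ := hlift A y hx
    exact mem_derive_sub_iff.2 ⟨z, hz, e.injective (by rw [he, he, hzy])⟩
  · obtain ⟨y, hy, rfl⟩ := mem_derive_sub_iff.1 hx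
    rw [he]
    exact hsum A y hy

end Integrate

end SSpace

instance {P : Type v} [PartialOrder P] [Finite P] : Finite (AntichainHat P) :=
  Finite.of_injective AntichainHat.carrier fun _ _ => AntichainHat.ext

/-! ### Indecomposables under differentiation -/

namespace SSpace

variable {k : Type u} [Field k] {S : Type v} [PartialOrder S]

theorem Equivalent.sub_eq_top_iff {U V : SSpace k S} (h : Equivalent U V) (s : S) :
    U.sub s = ⊤ ↔ V.sub s = ⊤ := by
  obtain ⟨e, he⟩ := h
  simp only [Submodule.eq_top_iff', ← he]
  exact e.surjective.forall.symm

theorem nontrivial_derive_iff {p : S} {V : SSpace k S} :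
    Nontrivial (derive p V).carrier ↔ V.sub p ≠ ⊤ :=
  Submodule.Quotient.nontrivial_iff

theorem toDerive_pow {p : S} {V : SSpace k S} {g : Module.End k V.carrier}
    {e : Module.End k (derive p V).carrier}
    (h : ∀ v, toDerive p V (g v) = e (toDerive p V v)) (n : ℕ) (v : V.carrier) :
    toDerive p V ((g ^ n) v) = (e ^ n) (toDerive p V v) := by
  induction n with
  | zero => rfl
  | succ n ih => rw [pow_succ', Module.End.mul_apply, h, ih, pow_succ', Module.End.mul_apply]

section

variable {p : S}

/-- Lift an idempotent `e` to `g`. If `g` is nilpotent, `e = e ^ (n + 1) = 0`; if `g` is bijective,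
`e` is surjective, hence `1`. -/
theorem IsIndecomposable.derive [Finite S] (hw : posetWidth ↥((Set.Ici p)ᶜ) ≤ 2)
    {V : SSpace k S} (hV : V.IsIndecomposable) (hp : V.sub p ≠ ⊤) :
    (derive p V).IsIndecomposable := by
  refine (isIndecomposable_iff _).2 ⟨nontrivial_derive_iff.2 hp, fun e he hi => ?_⟩
  obtain ⟨g, hg, hge⟩ := exists_compatible_of_derive hw he
  rcases hV.isNilpotent_or_injective hg with ⟨n, hn⟩ | hinj
  · left
    refine LinearMap.ext fun x => ?_
    obtain ⟨v, rfl⟩ := toDerive_surjective p V x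
    rw [← hi.pow_succ_eq n, ← toDerive_pow hge, pow_succ, hn, zero_mul]
    simp
  · right
    refine LinearMap.ext fun x => ?_
    obtain ⟨v, rfl⟩ := toDerive_surjective p V x
    obtain ⟨w, rfl⟩ := LinearMap.injective_iff_surjective.1 hinj v
    rw [hge]
    exact LinearMap.congr_fun hi _

/-- The identity of a nonzero derivative is not nilpotent, so Fitting leaves only injectivity. -/
theorem IsIndecomposable.injective_of_toDerive {V : SSpace k S} (hV : V.IsIndecomposable)
    (hp : V.sub p ≠ ⊤) {g : Module.End k V.carrier} (hg : Compatible V V g)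
    (h : ∀ v, toDerive p V (g v) = toDerive p V v) : Function.Injective g := by
  rcases hV.isNilpotent_or_injective hg with ⟨n, hn⟩ | hinj
  · have := nontrivial_derive_iff.2 hp
    obtain ⟨x, hx⟩ := exists_ne (0 : (SSpace.derive p V).carrier)
    obtain ⟨v, rfl⟩ := toDerive_surjective p V x
    have h1 := toDerive_pow (e := 1) h n v
    rw [hn, one_pow] at h1
    exact absurd (by simpa using h1.symm) hx
  · exact hinj

theorem Equivalent.of_derive [Finite S] (hw : posetWidth ↥((Set.Ici p)ᶜ) ≤ 2)
    {U V : SSpace k S} (hU : U.IsIndecomposable) (hV : V.IsIndecomposable) (hp : U.sub p ≠ ⊤) (hUV : Equivalent (SSpace.derive p U)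
    (SSpace.derive p V)) : Equivalent U V := by
  obtain ⟨e, he⟩ := hUV
  have hp' : V.sub p ≠ ⊤ := by
    rw [← nontrivial_derive_iff] at hp ⊢
    exact e.symm.toEquiv.nontrivial
  obtain ⟨f, hf, hfe⟩ := exists_compatible_of_derive hw (f := e.toLinearMap)
    (fun s x hx => (he s x).2 hx)
  obtain ⟨g, hg, hge⟩ := exists_compatible_of_derive hw (f := e.symm.toLinearMap)
    (fun s x hx => (he s _).1 (by simpa using hx))
  have hgf : Function.Injective (g ∘ₗ f) := hU.injective_of_toDerive hp (hg.comp hf) fun v => by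
    simp [hge, hfe]
  have hfg : Function.Injective (f ∘ₗ g) := hV.injective_of_toDerive hp' (hf.comp hg) fun v => by
    simp [hge, hfe]
  have hfi : Function.Injective f := Function.Injective.of_comp hgf
  have hfs : Function.Surjective f :=
    Function.Surjective.of_comp (g := g) (LinearMap.injective_iff_surjective.1 hfg)
  exact ⟨LinearEquiv.ofBijective f ⟨hfi, hfs⟩, fun s x =>
    ⟨fun h => ((hg.comp hf).mem_iff_of_injective hgf s x).1 (hg s _ h), hf s x⟩⟩

/-- Take an integral `V` of least dimension. An idempotent inducing the identity on the derivative
has a range with the same derivative, so it is `1`. Any idempotent induces `0` or `1`; in the first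
case pass to `1 - e`. -/
theorem exists_isIndecomposable_derive_equivalent [Finite S] {W : SSpace k (derivedPoset p)}
    (hW : W.IsIndecomposable) :
    ∃ V : SSpace k S, V.IsIndecomposable ∧ Equivalent (SSpace.derive p V) W := by
  obtain ⟨V, hVW, hmin⟩ := (measure fun V : SSpace k S => Module.finrank k V.carrier).wf.has_min
    {V | Equivalent (SSpace.derive p V) W}
    ⟨_, equivalent_derive_integrate (Finite.equivFin (derivedPoset p)) W⟩
  refine ⟨V, ?_, hVW⟩
  have hdV := hVW.symm.isIndecomposable hW
  have key : ∀ e : Module.End k V.carrier, Compatible V V e → IsIdempotentElem e →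
      (∀ v, toDerive p V (e v) = toDerive p V v) → e = 1 := by
    intro e he hi hd
    have hee : ∀ x, e (e x) = e x := fun x => LinearMap.congr_fun hi x
    set V' := V.restrict (LinearMap.range e)
    let ι : V'.carrier →ₗ[k] V.carrier := (LinearMap.range e).subtype
    let π : V.carrier →ₗ[k] V'.carrier := e.rangeRestrict
    have hι : Compatible V' V ι := fun s x hx => hx
    have hπ : Compatible V V' π := fun s x hx => he s x hx
    have hEq : Equivalent (SSpace.derive p V') (SSpace.derive p V) := by
      refine equivalent_of_inverse (compatible_deriveMap hι) (compatible_deriveMap hπ)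
        (fun x => ?_) (fun x => ?_)
      · obtain ⟨⟨_, v, rfl⟩, rfl⟩ := toDerive_surjective p V' x
        exact congrArg (toDerive p V') (Subtype.ext (hee v))
      · obtain ⟨v, rfl⟩ := toDerive_surjective p V x
        exact hd v
    have hlt : ¬ Module.finrank k (LinearMap.range e) < Module.finrank k V.carrier :=
      hmin V' (hEq.trans hVW)
    have hr : LinearMap.range e = ⊤ :=
      Submodule.eq_top_of_finrank_eq (le_antisymm (Submodule.finrank_le _) (not_lt.1 hlt))
    refine LinearMap.ext fun x => ?_
    obtain ⟨y, rfl⟩ := LinearMap.range_eq_top.1 hr x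
    exact hee y
  refine (isIndecomposable_iff V).2 ⟨?_, fun e he hi => ?_⟩
  · have := ((isIndecomposable_iff _).1 hdV).1
    exact (toDerive_surjective p V).nontrivial
  rcases ((isIndecomposable_iff _).1 hdV).2 (deriveMap p he) (compatible_deriveMap he)
    (LinearMap.ext fun x => by
      obtain ⟨v, rfl⟩ := toDerive_surjective p V x
      exact congrArg (toDerive p V) (LinearMap.congr_fun hi v)) with h0 | h0
  · left
    have h1 := key (1 - e) (fun s x hx => Submodule.sub_mem _ hx (he s x hx)) hi.one_sub
      fun v => by
        have : toDerive p V (e v) = 0 := LinearMap.congr_fun h0 (toDerive p V v)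
        simp [this]
    simpa using h1
  · right
    exact key e he hi fun v => LinearMap.congr_fun h0 (toDerive p V v)

end

/-! ### Indecomposables with `V(p) = V` -/

section Line

variable {p : S}

/-- The filter of `S` generated by `p` and an antichain, possibly empty, in the complement of the
principal filter `⟨p⟩`. -/
def filterOf (A : Option (AntichainHat ↥((Set.Ici p)ᶜ))) : Set S :=
  {s | p ≤ s ∨ ∃ B ∈ A, ∃ a ∈ B.carrier, (a : S) ≤ s}

/-- Inclusion of filters forces the reverse order on antichains, and that order is antisymmetric. -/
theorem filterOf_injective :
    Function.Injective (filterOf : Option (AntichainHat ↥((Set.Ici p)ᶜ)) → Set S) := by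
  have hsub : ∀ (A : Option (AntichainHat ↥((Set.Ici p)ᶜ))) (B : AntichainHat ↥((Set.Ici p)ᶜ)),
      filterOf (some B) ⊆ filterOf A → ∃ A', A = some A' ∧ A' ≤ B := by
    intro A B h
    have h1 : ∀ b ∈ B.carrier, ∃ A' ∈ A, ∃ a ∈ A'.carrier, a ≤ b := fun b hb =>
      (h (Or.inr ⟨B, rfl, b, hb, le_rfl⟩)).resolve_left b.2
    obtain ⟨b, hb⟩ := B.nonempty
    obtain ⟨A', hA', -⟩ := h1 b hb
    refine ⟨A', hA', fun b hb => ?_⟩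
    obtain ⟨A'', hA'', h2⟩ := h1 b hb
    rwa [Option.mem_unique hA' hA'']
  rintro (_ | A) (_ | B) h
  · rfl
  · obtain ⟨_, h1, -⟩ := hsub _ B h.ge
    cases h1
  · obtain ⟨_, h1, -⟩ := hsub _ A h.le
    cases h1
  · obtain ⟨_, h1, hAB⟩ := hsub _ B h.ge
    obtain ⟨_, h2, hBA⟩ := hsub _ A h.le
    cases h1
    cases h2
    rw [le_antisymm hAB hBA]

theorem exists_filterOf_eq [Finite S] {F : Set S} (hF : IsUpperSet F) (hp : p ∈ F) :
    ∃ A : Option (AntichainHat ↥((Set.Ici p)ᶜ)), filterOf A = F := by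
  have hmin : ∀ x : ↥((Set.Ici p)ᶜ), (x : S) ∈ F →
      ∃ a ≤ x, Minimal (fun y : ↥((Set.Ici p)ᶜ) => (y : S) ∈ F) a := fun x hx =>
    (Set.toFinite {y : ↥((Set.Ici p)ᶜ) | (y : S) ∈ F}).exists_le_minimal hx
  by_cases h0 : ∃ x : ↥((Set.Ici p)ᶜ), (x : S) ∈ F
  · refine ⟨some ⟨{a | Minimal (fun y : ↥((Set.Ici p)ᶜ) => (y : S) ∈ F) a},
      setOfPred_minimal_antichain _, ?_⟩, Set.Subset.antisymm ?_ fun s hs => ?_⟩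
    · obtain ⟨x, hx⟩ := h0
      obtain ⟨a, -, ha⟩ := hmin x hx
      exact ⟨a, ha⟩
    · rintro s (hs | ⟨B, hB, a, ha, has⟩)
      · exact hF hs hp
      · cases hB
        exact hF has ha.1
    · by_cases hps : p ≤ s
      · exact Or.inl hps
      · obtain ⟨a, has, ha⟩ := hmin ⟨s, hps⟩ hs
        exact Or.inr ⟨_, rfl, a, ha, has⟩
  · refine ⟨none, Set.Subset.antisymm ?_ fun s hs => ?_⟩
    · rintro s (hs | ⟨B, hB, -⟩)
      · exact hF hs hp
      · cases hB
    · by_contra h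
      exact h0 ⟨⟨s, fun hps => h (Or.inl hps)⟩, hs⟩

/-- The one-dimensional `S`-space attached to a filter. -/
def line (k : Type u) [Field k] (A : Option (AntichainHat ↥((Set.Ici p)ᶜ))) : SSpace k S where
  carrier := k
  -- This is `⊤` on the filter and `⊥` off it.
  sub s := ⨆ _ : s ∈ filterOf A, ⊤
  sub_mono s t h := iSup_le fun hs => le_iSup_of_le (by
    rcases hs with hs | ⟨B, hB, a, ha, has⟩
    · exact Or.inl (hs.trans h)
    · exact Or.inr ⟨B, hB, a, ha, has.trans h⟩) le_rfl

theorem mem_line_sub_iff {A : Option (AntichainHat ↥((Set.Ici p)ᶜ))} {s : S} {c : k} :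
    c ∈ (⨆ _ : s ∈ filterOf A, ⊤ : Submodule k k) ↔ c = 0 ∨ s ∈ filterOf A := by
  by_cases h : s ∈ filterOf A <;> simp [h]

theorem line_sub_self (A : Option (AntichainHat ↥((Set.Ici p)ᶜ))) : (line k A).sub p = ⊤ :=
  eq_top_iff.2 fun _ _ => (mem_line_sub_iff (k := k)).2 (Or.inr (Or.inl le_rfl))

theorem isIndecomposable_line (A : Option (AntichainHat ↥((Set.Ici p)ᶜ))) :
    (line k A).IsIndecomposable := by
  refine (isIndecomposable_iff _).2 ⟨inferInstanceAs (Nontrivial k), fun e _ hi => ?_⟩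
  let e' : k →ₗ[k] k := e
  have hee : e' (e' 1) = e' 1 := LinearMap.congr_fun hi (1 : k)
  have hlin : ∀ c, e' c = c * e' 1 := fun c => by
    rw [← smul_eq_mul, ← map_smul, smul_eq_mul, mul_one]
  rw [hlin] at hee
  rcases IsIdempotentElem.iff_eq_zero_or_one.1 hee with h | h
  · left
    exact LinearMap.ext fun c : k => ((hlin c).trans (congrArg (c * ·) h)).trans (mul_zero c)
  · right
    exact LinearMap.ext fun c : k => ((hlin c).trans (congrArg (c * ·) h)).trans (mul_one c)

theorem eq_of_equivalent_line {A B : Option (AntichainHat ↥((Set.Ici p)ᶜ))}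
    (h : Equivalent (line k A) (line k B)) : A = B := by
  obtain ⟨e, he⟩ := h
  let e' : k ≃ₗ[k] k := e
  refine filterOf_injective (Set.ext fun s => ?_)
  have h1 := he s (1 : k)
  have h2 : e' 1 ≠ 0 := fun h => one_ne_zero (e'.map_eq_zero_iff.1 h)
  have h3 := ((mem_line_sub_iff (k := k)).symm.trans h1).trans (mem_line_sub_iff (k := k))
  have h4 : (e' 1 = 0 ∨ s ∈ filterOf B) ↔ ((1 : k) = 0 ∨ s ∈ filterOf A) := h3
  simpa [h2] using h4.symm

/-- The projection to a split line is compatible also on `⟨p⟩`, where `V(s) = V`. It is a nonzero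
idempotent, hence `1`, so `v` spans `V`. -/
theorem exists_equivalent_line [Finite S] (hw : posetWidth ↥((Set.Ici p)ᶜ) ≤ 2) {V : SSpace k S}
    (hV : V.IsIndecomposable) (hp : V.sub p = ⊤) :
    ∃ A : Option (AntichainHat ↥((Set.Ici p)ᶜ)), Equivalent (line k A) V := by
  obtain ⟨hnt, hV⟩ := (isIndecomposable_iff V).1 hV
  obtain ⟨v, φ, hφ, hv⟩ := exists_line_splitting hw
    (V := fun x : ↥((Set.Ici p)ᶜ) => V.sub x) (fun x y h => V.sub_mono x y h)
  have htop : ∀ s, p ≤ s → V.sub s = ⊤ := fun s hs => top_le_iff.1 (hp ▸ V.sub_mono p s hs)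
  have hcomp : Compatible V V (φ.smulRight v) := by
    intro s x hx
    by_cases hs : p ≤ s
    · rw [htop s hs]
      trivial
    · rcases hv ⟨s, hs⟩ with h | h
      · exact Submodule.smul_mem _ _ h
      · have : φ x = 0 := h hx
        simp [this]
  have hone : φ.smulRight v = 1 := by
    refine (hV _ hcomp (LinearMap.ext fun x => by simp [hφ])).resolve_left fun h => ?_
    have h1 : φ v • v = 0 := LinearMap.congr_fun h v
    rw [hφ, one_smul] at h1
    simp [h1] at hφ
  obtain ⟨A, hA⟩ := exists_filterOf_eq (p := p) (F := {s | v ∈ V.sub s})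
    (fun s t h hs => V.sub_mono s t h hs) (by simp [hp])
  refine ⟨A, LinearEquiv.ofLinearMap (LinearMap.toSpanSingleton k V.carrier v) φ
    (LinearMap.ext fun x => LinearMap.congr_fun hone x)
    (LinearMap.ext fun c : k => by
      change φ (c • v) = c
      simp [hφ]), fun s (c : k) => ?_⟩
  refine Iff.trans (b := c • v ∈ V.sub s) Iff.rfl (Iff.trans ?_ (mem_line_sub_iff (k := k)).symm)
  rw [hA]
  rcases eq_or_ne c 0 with h | h
  · simp [h]
  · rw [Submodule.smul_mem_iff _ h]
    simp [h]

end Line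

/-! ### Counting isomorphism classes -/

theorem mk_eq_mk_iff {U V : SSpace k S} :
    Quotient.mk (isIsomorphicSetoid (SSpace k S)) U = Quotient.mk _ V ↔ Equivalent U V :=
  Quotient.eq.trans nonempty_iso_iff

/-- Differentiation on isomorphism classes. -/
def deriveClass (k : Type u) [Field k] (p : S) : Quotient (isIsomorphicSetoid (SSpace k S)) →
    Quotient (isIsomorphicSetoid (SSpace k (derivedPoset p))) :=
  Quotient.map (SSpace.derive p) fun _ _ h =>
    nonempty_iso_iff.2 ((nonempty_iso_iff.1 h).derive p)

theorem mk_indecClasses_sub_ne_top [Finite S] {p : S} (hw : posetWidth ↥((Set.Ici p)ᶜ) ≤ 2) :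
    Cardinal.mk {x | ∃ V : SSpace k S, V.IsIndecomposable ∧ V.sub p ≠ ⊤ ∧
      Quotient.mk (isIsomorphicSetoid _) V = x} = nu k ↥(derivedPoset p) := by
  refine Cardinal.mk_congr (Set.BijOn.equiv (deriveClass k p) ⟨?_, ?_, ?_⟩)
  · rintro _ ⟨V, hV, hp, rfl⟩
    exact ⟨_, hV.derive hw hp, rfl⟩
  · rintro _ ⟨U, hU, hp, rfl⟩ _ ⟨V, hV, -, rfl⟩ h
    exact mk_eq_mk_iff.2 (Equivalent.of_derive hw hU hV hp (mk_eq_mk_iff.1 h))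
  · rintro _ ⟨W, hW, rfl⟩
    obtain ⟨V, hV, hVW⟩ := exists_isIndecomposable_derive_equivalent hW
    have := ((isIndecomposable_iff _).1 (hVW.symm.isIndecomposable hW)).1
    exact ⟨_, ⟨V, hV, nontrivial_derive_iff.1 this, rfl⟩, mk_eq_mk_iff.2 hVW⟩

theorem mk_indecClasses_sub_eq_top [Finite S] {p : S} (hw : posetWidth ↥((Set.Ici p)ᶜ) ≤ 2) :
    Cardinal.mk {x | ∃ V : SSpace k S, V.IsIndecomposable ∧ V.sub p = ⊤ ∧
      Quotient.mk (isIsomorphicSetoid _) V = x} =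
    (Nat.card (AntichainHat ↥((Set.Ici p)ᶜ)) : Cardinal) + 1 := by
  let f : Option (AntichainHat ↥((Set.Ici p)ᶜ)) → {x | ∃ V : SSpace k S, V.IsIndecomposable ∧
      V.sub p = ⊤ ∧ Quotient.mk (isIsomorphicSetoid _) V = x} :=
    fun A => ⟨_, line k A, isIndecomposable_line A, line_sub_self A, rfl⟩
  have hf : Function.Bijective f := by
    refine ⟨fun A B h => eq_of_equivalent_line (mk_eq_mk_iff.1 (congrArg Subtype.val h)), ?_⟩
    rintro ⟨_, V, hV, hp, rfl⟩
    obtain ⟨A, hA⟩ := exists_equivalent_line hw hV hp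
    exact ⟨A, Subtype.ext (mk_eq_mk_iff.2 hA)⟩
  have := Finite.of_surjective f hf.2
  rw [← Nat.cast_card, ← Nat.card_congr (Equiv.ofBijective f hf), Finite.card_option,
    Nat.cast_add, Nat.cast_one]

end SSpace

open SSpace in
theorem nu_eq_nu_derivedPoset_add {k : Type u} [Field k] {S : Type v} [PartialOrder S] [Finite S]
    {p : S} (hw : posetWidth ↥((Set.Ici p)ᶜ) ≤ 2) :
    nu k S =
      nu k ↥(derivedPoset p) + (Nat.card (AntichainHat ↥((Set.Ici p)ᶜ)) : Cardinal) + 1 := by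
  rw [add_assoc, ← mk_indecClasses_sub_eq_top (k := k) hw,
    ← mk_indecClasses_sub_ne_top hw,
    ← Cardinal.mk_union_of_disjoint]
  · refine congrArg (fun s : Set _ => Cardinal.mk s) (Set.ext fun x => ⟨?_, ?_⟩)
    · rintro ⟨V, hV, rfl⟩
      by_cases hp : V.sub p = ⊤
      · exact Or.inr ⟨V, hV, hp, rfl⟩
      · exact Or.inl ⟨V, hV, hp, rfl⟩
    · rintro (⟨V, hV, -, rfl⟩ | ⟨V, hV, -, rfl⟩) <;> exact ⟨V, hV, rfl⟩
  · rw [Set.disjoint_left]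
    rintro _ ⟨U, -, hU, rfl⟩ ⟨V, -, hV, h⟩
    exact hU (((mk_eq_mk_iff.1 h).sub_eq_top_iff p).1 hV)

theorem corollary5p11 {k : Type u} [Field k] {S : Type v} [PartialOrder S] [Finite S] (p : S)
    (hw : posetWidth ↥((Set.Ici p)ᶜ) ≤ 2) :
    nu k S = nu k ↥(derivedPoset p) + (Nat.card (AntichainHat ↥((Set.Ici p)ᶜ)) : Cardinal) + 1 ∧
      (FinitelyRepresented k S ↔ FinitelyRepresented k ↥(derivedPoset p)) := by
  refine ⟨nu_eq_nu_derivedPoset_add hw, ?_⟩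
  unfold FinitelyRepresented
  rw [nu_eq_nu_derivedPoset_add hw, Cardinal.add_lt_aleph0_iff, Cardinal.add_lt_aleph0_iff]
  simp [Cardinal.natCast_lt_aleph0]
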